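/- **Conventions.** Trees are finite rooted trees with a planar structure (an ordering of the inputs of every vertex), leaves and vertices without inputs being allowed; a leaf is an edge that is not the output of a vertex, an internal edge is one that is neither a leaf nor the root, and $\eta$ is the tree with one edge and no vertices. For a tree $T$ let $\Omega(T)$ be the free colored symmetric operad on the vertices of $T$, with the edges of $T$ as colors. The dendroidal category $\Omega$ has trees as objects and the maps of colored operads $\Omega(S)\to\Omega(T)$ as morphisms $S\to T$ (planar structures need not be preserved), and $\Omega_{\mathrm{inj}}$ is its wide subcategory generated by isomorphisms and (inner and outer) face maps. A semi-dendroidal space is a presheaf of topological spaces on $\Omega_{\mathrm{inj}}$. An *operad with shifts* is a colored symmetric operad $\mathcal O$ in topological spaces with color set $\{1,2\}$ such that $\mathcal O(\ell;2)$ is a point if $\ell=(2)$ and is empty for every other list $\ell$, together with weak homotopy equivalences $\mathfrak s_{\ell,\ell'}:\mathcal O(\ell;1)\to\mathcal O(\ell';1)$ for all lists $\ell\le\ell'$ of equal length (compared entrywise), such that $\mathfrak s_{\ell',\ell''}\mathfrak s_{\ell,\ell'}=\mathfrak s_{\ell,\ell''}$, $\ \mathfrak s_{\ell,\ell}=\mathrm{id}$,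 $\ \sigma^*\mathfrak s_{\ell,\ell'}=\mathfrak s_{\ell\cdot\sigma,\ell'\cdot\sigma}\sigma^*$ for permutations $\sigma$, and $(\mathfrak s_{\ell,\ell'}x)\circ_i(\mathfrak s_{m,m'}y)=\mathfrak s_{\ell\circ_i m,\,\ell'\circ_i m'}(x\circ_i y)$ whenever $\ell\le\ell'$, $m\le m'$ and $\ell_i=\ell'_i=1$. Let $N_d(\mathcal O)_T$ be the space of operad maps $\Omega(T)\to\mathcal O$. Its points are the pairs $(f_0,f_1)$ of a function $f_0$ from the edges of $T$ to $\{1,2\}$ and a family of operations $f_1(v)\in\mathcal O(f_0(\mathrm{in}(v));f_0(\mathrm{out}(v)))$ indexed by the vertices $v$ of $T$; it is topologized as the disjoint union over $f_0$ of the products over $v$ of the spaces of operations. For a morphism $\alpha:S\to T$ of $\Omega$ let $\alpha^*:N_d(\mathcal O)_T\to N_d(\mathcal O)_S$ be composition with $\alpha$. Let $\mathfrak s_T(f_0,f_1)=(f_0',f_1')$, where $f_0'$ is $2$ on leaves and agrees with $f_0$ on all other edges, and $f_1'(v)=\mathfrak s_{\ell_v,\ell_v'}f_1(v)$ for $\ell_v=f_0(\mathrm{in}(v))$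 and $\ell'_v=f'_0(\mathrm{in}(v))$ (with $f_1'(v)=f_1(v)$ if $f_0(\mathrm{out}(v))=2$). Put $X_\eta=*$ and, for $T\neq\eta$, let $X_T\subseteq N_d(\mathcal O)_T$ be the subspace of operad maps sending all leaves to $2$ and the root and all internal edges to $1$. For $\alpha:S\to T$ in $\Omega_{\mathrm{inj}}$ let $\hat\alpha:X_T\to X_S$ be the restriction of $\mathfrak s_S\circ\alpha^*$ if $S\ne\eta$ (it takes values in $X_S$), and the unique map $X_T\to *$ if $S=\eta$. **Theorem.** Let $\mathcal O$ be an operad with shifts. The spaces $X_T$ together with the operators $\hat\alpha$, for $\alpha$ in $\Omega_{\mathrm{inj}}$, constitute a semi-dendroidal space: every $\hat\alpha$ is continuous, and $T\mapsto X_T$, $\alpha\mapsto\hat\alpha$ is a functor $\Omega_{\mathrm{inj}}^{\mathrm{op}}\to\mathrm{Top}$. In particular, if $\alpha\beta=\alpha'\beta'$ in $\Omega_{\mathrm{inj}}$, then $\hat\beta\hat\alpha=\hat\beta'\hat\alpha'$, so that the relations among face maps and isomorphisms hold for the hat-operators. -/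

import Mathlib

open CategoryTheory

universe u u₁ u₂ u₃ v w

namespace Dendroidal

/-! ### Substitution of lists

A list of length `p` in a set `C` is a function `l : Fin p → C` (positions are counted from `0`). -/

/-- The positions of the list obtained from a list of length `p` by replacing its `i`-th entry by a
list of length `q`: positions `< i` and `≥ i + q` come from the first list, the positions
`i, …, i + q - 1` from the second one. -/
def slot {p : ℕ} (i : Fin p) (q : ℕ) : Fin (p - 1 + q) ≃ {k : Fin p // k ≠ i} ⊕ Fin q where
  toFun k :=
    if h₁ : k.1 < i.1 then Sum.inl ⟨⟨k.1, by omega⟩, by intro h; simp [← h] at h₁⟩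
    else if h₂ : k.1 < i.1 + q then Sum.inr ⟨k.1 - i.1, by omega⟩
    else Sum.inl ⟨⟨k.1 + 1 - q, by omega⟩, by
      intro h; have h' := congrArg Fin.val h; simp only at h'; omega⟩
  invFun x := match x with
    | Sum.inl k =>
      if h : k.1.1 < i.1 then ⟨k.1.1, by omega⟩
      else ⟨k.1.1 - 1 + q, by have h' : k.1.1 ≠ i.1 := fun e => k.2 (Fin.ext e); omega⟩
    | Sum.inr j => ⟨i.1 + j.1, by omega⟩
  left_inv k := by
    dsimp only
    split_ifs with h₁ h₂
    · simp [h₁]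
    · ext; simp only; omega
    · simp only
      rw [dif_neg (by omega)]
      ext; simp only; omega
  right_inv x := by
    rcases x with ⟨k, hk⟩ | j
    · have hk' : k.1 ≠ i.1 := fun h => hk (Fin.ext h)
      by_cases h : k.1 < i.1
      · simp [h]
      · simp only [dif_neg h]
        rw [dif_neg (by omega), dif_neg (by omega)]
        congr 2
        ext; simp only; omega
    · simp only
      rw [dif_neg (by omega), dif_pos (by omega)]
      congr 1
      ext; simp only; omega

/-- `graft l i m` is the list `l ∘ᵢ m`, i.e. `l` with its `i`-th entry replaced by the list `m`. -/
def graft {C : Type v} {p q : ℕ} (l : Fin p → C) (i : Fin p) (m : Fin q → C) :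
    Fin (p - 1 + q) → C :=
  fun k => Sum.elim (fun k' : {k : Fin p // k ≠ i} => l k'.1) m (slot i q k)

theorem graft_slot {C : Type v} {p q : ℕ} (l : Fin p → C) (i : Fin p) (m : Fin q → C)
    (x : {k : Fin p // k ≠ i} ⊕ Fin q) :
    graft l i m ((slot i q).symm x) = Sum.elim (fun k' : {k : Fin p // k ≠ i} => l k'.1) m x := by
  simp [graft]

theorem comp_graft {C : Type v} {D : Type w} (f : C → D) {p q : ℕ} (l : Fin p → C) (i : Fin p)
    (m : Fin q → C) : f ∘ graft l i m = graft (f ∘ l) i (f ∘ m) := by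
  funext k
  simp only [graft, Function.comp]
  rcases slot i q k with x | x <;> rfl

theorem comp_graft' {C : Type v} {D : Type w} (f : C → D) {p q : ℕ} (l : Fin p → C) (i : Fin p)
    (m : Fin q → C) :
    f ∘ graft l i m = graft (f ∘ l) i (f ∘ m) ∘ Equiv.refl (Fin (p - 1 + q)) :=
  comp_graft f l i m

/-- The block bijection `σ ∘ᵢ τ` on positions induced by bijections `σ` and `τ`. -/
def blockEquiv {p p' q q' : ℕ} (σ : Fin p' ≃ Fin p) (i : Fin p') (τ : Fin q' ≃ Fin q) :
    Fin (p' - 1 + q') ≃ Fin (p - 1 + q) :=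
  ((slot i q').trans
    (Equiv.sumCongr (σ.subtypeEquiv fun _ => (not_congr σ.injective.eq_iff).symm) τ)).trans
      (slot (σ i) q).symm

theorem graft_blockEquiv {C : Type v} {p p' q q' : ℕ} (σ : Fin p' ≃ Fin p) (i : Fin p')
    (τ : Fin q' ≃ Fin q) (l : Fin p → C) (m : Fin q → C) :
    graft (l ∘ σ) i (m ∘ τ) = graft l (σ i) m ∘ blockEquiv σ i τ := by
  funext k
  simp only [blockEquiv, Function.comp, Equiv.trans_apply, graft_slot]
  simp only [graft]
  rcases slot i q' k with x | x <;> rfl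

theorem unit_arity {q : ℕ} : 1 - 1 + q = q := by omega

theorem graft_unit_left {C : Type v} {q : ℕ} (c : C) (m : Fin q → C) :
    graft (fun _ : Fin 1 => c) 0 m = m ∘ finCongr unit_arity := by
  funext k
  have h : slot (0 : Fin 1) q k = Sum.inr (finCongr unit_arity k) := by
    rw [← Equiv.eq_symm_apply]
    ext; simp [slot]
  simp [graft, h]

theorem graft_unit_right {C : Type v} {p : ℕ} (l : Fin p → C) (i : Fin p) :
    graft l i (fun _ : Fin 1 => l i) = l ∘ finCongr (Nat.sub_add_cancel i.pos) := by
  funext k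
  obtain ⟨x, rfl⟩ := (slot i 1).symm.surjective k
  rw [graft_slot]
  rcases x with ⟨x, hx⟩ | x
  · have hx' : x.1 ≠ i.1 := fun h => hx (Fin.ext h)
    simp only [Sum.elim_inl, Function.comp]
    congr 1
    ext
    simp only [slot, Equiv.coe_fn_symm_mk, finCongr_apply, Fin.val_cast]
    split_ifs
    · rfl
    · simp only; omega
  · simp only [Sum.elim_inr, Function.comp]
    congr 1
    ext
    simp [slot]

theorem graft_apply {C : Type v} {p q : ℕ} (l : Fin p → C) (i : Fin p) (m : Fin q → C)
    (k : Fin (p - 1 + q)) :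
    graft l i m k =
      if h₁ : k.1 < i.1 then l ⟨k.1, by omega⟩
      else if h₂ : k.1 < i.1 + q then m ⟨k.1 - i.1, by omega⟩
      else l ⟨k.1 + 1 - q, by omega⟩ := by
  simp only [graft, slot, Equiv.coe_fn_mk]
  split_ifs <;> rfl

theorem slot_symm_inl_of_lt {p q : ℕ} {i k : Fin p} (h : k ≠ i) (hlt : k.1 < i.1) :
    ((slot i q).symm (Sum.inl ⟨k, h⟩)).1 = k.1 := by
  simp only [slot, Equiv.coe_fn_symm_mk]
  rw [dif_pos hlt]

theorem slot_symm_inl_of_gt {p q : ℕ} {i k : Fin p} (h : k ≠ i) (hlt : i.1 < k.1) :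
    ((slot i q).symm (Sum.inl ⟨k, h⟩)).1 = k.1 - 1 + q := by
  simp only [slot, Equiv.coe_fn_symm_mk]
  rw [dif_neg (by omega)]

theorem slot_symm_inr {p q : ℕ} (i : Fin p) (j : Fin q) :
    ((slot i q).symm (Sum.inr j)).1 = i.1 + j.1 := rfl

theorem assoc_arity {p q r : ℕ} (i : Fin p) (j : Fin q) :
    p - 1 + q - 1 + r = p - 1 + (q - 1 + r) := by
  have := i.2; have := j.2; omega

theorem graft_assoc {C : Type v} {p q r : ℕ} (l : Fin p → C) (i : Fin p) (m : Fin q → C)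
    (j : Fin q) (n : Fin r → C) :
    graft (graft l i m) ((slot i q).symm (Sum.inr j)) n =
      graft l i (graft m j n) ∘ finCongr (assoc_arity i j) := by
  have hi := i.2
  have hj := j.2
  funext k
  have hk := k.2
  simp only [graft_apply, slot_symm_inr, Function.comp, finCongr_apply, Fin.val_cast]
  split_ifs <;> first
    | (exfalso; omega)
    | rfl
    | exact congrArg l (Fin.ext (by simp only; omega))
    | exact congrArg m (Fin.ext (by simp only; omega))
    | exact congrArg n (Fin.ext (by simp only; omega))

theorem parallel_arity {p q r : ℕ} {i k : Fin p} (h : k ≠ i) :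
    p - 1 + q - 1 + r = p - 1 + r - 1 + q := by
  have := i.2; have := k.2
  have h' : k.1 ≠ i.1 := fun e => h (Fin.ext e)
  omega

theorem graft_parallel {C : Type v} {p q r : ℕ} (l : Fin p → C) {i k : Fin p} (h : k ≠ i)
    (m : Fin q → C) (n : Fin r → C) :
    graft (graft l i m) ((slot i q).symm (Sum.inl ⟨k, h⟩)) n =
      graft (graft l k n) ((slot k r).symm (Sum.inl ⟨i, h.symm⟩)) m ∘
        finCongr (parallel_arity h) := by
  have hi := i.2
  have hk := k.2
  have h' : k.1 ≠ i.1 := fun e => h (Fin.ext e)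
  funext t
  have ht := t.2
  rcases lt_or_gt_of_ne h' with h1 | h1
  · simp only [graft_apply, slot_symm_inl_of_lt h h1, slot_symm_inl_of_gt h.symm h1, Function.comp,
      finCongr_apply, Fin.val_cast]
    split_ifs <;> first
    | (exfalso; omega)
    | rfl
    | exact congrArg l (Fin.ext (by simp only; omega))
    | exact congrArg m (Fin.ext (by simp only; omega))
    | exact congrArg n (Fin.ext (by simp only; omega))
  · simp only [graft_apply, slot_symm_inl_of_gt h h1, slot_symm_inl_of_lt h.symm h1, Function.comp,
      finCongr_apply, Fin.val_cast]
    split_ifs <;> first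
    | (exfalso; omega)
    | rfl
    | exact congrArg l (Fin.ext (by simp only; omega))
    | exact congrArg m (Fin.ext (by simp only; omega))
    | exact congrArg n (Fin.ext (by simp only; omega))

/-! ### Colored symmetric operads -/

/-- A colored symmetric operad (in sets) with set of colors `C`, given by units, partial
compositions `∘ᵢ` and symmetric group actions.
`perm σ h` is the operator `σ^* : 𝒪(l; c) → 𝒪(l · σ; c)`; the list `l · σ` is allowed to be given
up to a propositional equality, so `perm` also transports along equalities of lists. -/
structure SymmOperad (C : Type v) where
  /-- The set `𝒪(l; c)`. -/
  Ops : {p : ℕ} → (Fin p → C) → C → Type u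
  /-- The unit `id_c ∈ 𝒪(c; c)`. -/
  unit : (c : C) → Ops (fun _ : Fin 1 => c) c
  /-- The symmetric group action. -/
  perm : {p q : ℕ} → {l : Fin p → C} → {l' : Fin q → C} → {c : C} → (σ : Fin q ≃ Fin p) →
    l' = l ∘ σ → Ops l c → Ops l' c
  /-- The partial composition `x ∘ᵢ y`. -/
  comp : {p q : ℕ} → {l : Fin p → C} → {m : Fin q → C} → {c d : C} → Ops l c → (i : Fin p) →
    Ops m d → d = l i → Ops (graft l i m) c
  perm_refl : ∀ {p : ℕ} {l : Fin p → C} {c : C} (x : Ops l c),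
    perm (Equiv.refl (Fin p)) rfl x = x
  perm_perm : ∀ {p q r : ℕ} {l : Fin p → C} {c : C} (σ : Fin q ≃ Fin p) (τ : Fin r ≃ Fin q)
    (x : Ops l c), perm (l' := (l ∘ σ) ∘ τ) τ rfl (perm σ rfl x) = perm (τ.trans σ) rfl x
  comp_perm : ∀ {p p' q q' : ℕ} {l : Fin p → C} {m : Fin q → C} {c d : C} (σ : Fin p' ≃ Fin p)
    (τ : Fin q' ≃ Fin q) (x : Ops l c) (i : Fin p') (y : Ops m d) (hd : d = l (σ i)),
    comp (perm (l' := l ∘ σ) σ rfl x) i (perm (l' := m ∘ τ) τ rfl y) hd =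
      perm (blockEquiv σ i τ) (graft_blockEquiv σ i τ l m) (comp x (σ i) y hd)
  unit_comp : ∀ {q : ℕ} {m : Fin q → C} {c : C} (y : Ops m c),
    comp (unit c) 0 y rfl = perm (finCongr unit_arity) (graft_unit_left c m) y
  comp_unit : ∀ {p : ℕ} {l : Fin p → C} {c : C} (x : Ops l c) (i : Fin p),
    comp x i (unit (l i)) rfl =
      perm (finCongr (Nat.sub_add_cancel i.pos)) (graft_unit_right l i) x
  /-- Sequential associativity: `(x ∘ᵢ y) ∘_{i+j} z = x ∘ᵢ (y ∘ⱼ z)`. -/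
  comp_assoc : ∀ {p q r : ℕ} {l : Fin p → C} {m : Fin q → C} {n : Fin r → C} {c d e : C}
    (x : Ops l c) (i : Fin p) (y : Ops m d) (hd : d = l i) (j : Fin q) (z : Ops n e)
    (he : e = m j),
    comp (comp x i y hd) ((slot i q).symm (Sum.inr j)) z
        (he.trans (graft_slot l i m (Sum.inr j)).symm) =
      perm (finCongr (assoc_arity i j)) (graft_assoc l i m j n) (comp x i (comp y j z he) hd)
  /-- Parallel associativity: compositions at two distinct entries `i ≠ k` of `x` commute. -/
  comp_parallel : ∀ {p q r : ℕ} {l : Fin p → C} {m : Fin q → C} {n : Fin r → C} {c d e : C}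
    (x : Ops l c) (i k : Fin p) (hki : k ≠ i) (y : Ops m d) (hd : d = l i) (z : Ops n e)
    (he : e = l k),
    comp (comp x i y hd) ((slot i q).symm (Sum.inl ⟨k, hki⟩)) z
        (he.trans (graft_slot l i m (Sum.inl ⟨k, hki⟩)).symm) =
      perm (finCongr (parallel_arity hki)) (graft_parallel l hki m n)
        (comp (comp x k z he) ((slot k r).symm (Sum.inl ⟨i, hki.symm⟩)) y
          (hd.trans (graft_slot l k n (Sum.inl ⟨i, hki.symm⟩)).symm))

/-- A map of colored operads `P → Q`: a function on colors together with functions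
`P(l; c) → Q(f l; f c)` compatible with units, compositions and symmetric group actions. -/
structure SymmOperad.Hom {C : Type v} {D : Type w} (P : SymmOperad.{u₁} C)
    (Q : SymmOperad.{u₂} D) where
  /-- The function on colors. -/
  color : C → D
  /-- The functions on operations. -/
  map : {p : ℕ} → {l : Fin p → C} → {c : C} → P.Ops l c → Q.Ops (color ∘ l) (color c)
  map_unit : ∀ c : C, map (P.unit c) = Q.unit (color c)
  map_perm : ∀ {p q : ℕ} {l : Fin p → C} {c : C} (σ : Fin q ≃ Fin p) (x : P.Ops l c),
    map (P.perm (l' := l ∘ σ) σ rfl x) = Q.perm σ rfl (map x)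
  map_comp : ∀ {p q : ℕ} {l : Fin p → C} {m : Fin q → C} {c d : C} (x : P.Ops l c) (i : Fin p)
    (y : P.Ops m d) (hd : d = l i),
    map (P.comp x i y hd) =
      Q.perm (Equiv.refl _) (comp_graft' color l i m)
        (Q.comp (map x) i (map y) (congrArg color hd))

namespace SymmOperad

theorem perm_perm' {C : Type v} (P : SymmOperad.{u} C) {p q r : ℕ} {l : Fin p → C}
    {l' : Fin q → C} {l'' : Fin r → C} {c : C} (σ : Fin q ≃ Fin p) (h : l' = l ∘ σ)
    (τ : Fin r ≃ Fin q) (h' : l'' = l' ∘ τ) (x : P.Ops l c) :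
    P.perm τ h' (P.perm σ h x) = P.perm (τ.trans σ) (by rw [h', h]; rfl) x := by
  subst h
  subst h'
  exact P.perm_perm σ τ x

theorem Hom.map_perm' {C : Type v} {D : Type w} {P : SymmOperad.{u₁} C} {Q : SymmOperad.{u₂} D}
    (f : Hom P Q) {p q : ℕ} {l : Fin p → C} {l' : Fin q → C} {c : C} (σ : Fin q ≃ Fin p)
    (h : l' = l ∘ σ) (x : P.Ops l c) :
    f.map (P.perm σ h x) = Q.perm σ (by rw [h]; rfl) (f.map x) := by
  subst h
  exact f.map_perm σ x

/-- The identity map of an operad. -/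
def Hom.id {C : Type v} (P : SymmOperad.{u} C) : Hom P P where
  color := _root_.id
  map x := x
  map_unit _ := rfl
  map_perm _ _ := rfl
  map_comp x i y hd := (P.perm_refl (P.comp x i y hd)).symm

/-- The composite `g ∘ f` of maps of operads. -/
def Hom.comp {C : Type v} {D : Type w} {E : Type*} {P : SymmOperad.{u₁} C}
    {Q : SymmOperad.{u₂} D} {R : SymmOperad.{u₃} E} (g : Hom Q R) (f : Hom P Q) : Hom P R where
  color := g.color ∘ f.color
  map x := g.map (f.map x)
  map_unit c := by rw [f.map_unit, g.map_unit]; rfl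
  map_perm σ x := by rw [f.map_perm, g.map_perm]
  map_comp x i y hd := by
    rw [f.map_comp, g.map_perm', g.map_comp, perm_perm']
    rfl

end SymmOperad

/-! ### Trees and the dendroidal category -/

/-- A finite rooted tree with a planar structure. `E` and `V` are the sets of edges and of vertices,
`out v` is the output edge of the vertex `v`, and `inp v 0, …, inp v (arity v - 1)` are the input
edges of `v`, in the order given by the planar structure. Every edge is connected to the root by a
descending path. Stumps (vertices without inputs) are allowed. -/
structure PlanarTree where
  E : Type
  V : Type
  finite_E : Finite E
  finite_V : Finite V
  root : E
  out : V → E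
  arity : V → ℕ
  inp : (v : V) → Fin (arity v) → E
  out_injective : Function.Injective out
  inp_injective : Function.Injective fun x : (v : V) × Fin (arity v) => inp x.1 x.2
  inp_ne_root : ∀ (v : V) (i : Fin (arity v)), inp v i ≠ root
  exists_path : ∀ e : E,
    Relation.ReflTransGen (fun a b => ∃ (v : V) (i : Fin (arity v)), inp v i = a ∧ out v = b) e root

namespace PlanarTree

/-- The set of input edges of a vertex. -/
def inputs (T : PlanarTree) (v : T.V) : Set T.E := Set.range (T.inp v)

/-- A leaf is an edge which is not the output of a vertex. -/
def IsLeaf (T : PlanarTree) (e : T.E) : Prop := ∀ v : T.V, T.out v ≠ e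

/-- An internal edge is an edge which is neither the root nor a leaf. -/
def IsInternal (T : PlanarTree) (e : T.E) : Prop := e ≠ T.root ∧ ¬ T.IsLeaf e

/-- `T` is (isomorphic to) the trivial tree `η`: it has no vertices, hence exactly one edge. -/
def IsEta (T : PlanarTree) : Prop := IsEmpty T.V

/-- `T.Op l e` says that there is an operation with inputs `l` and output `e` in the free colored
operad generated by the vertices of `T`. Such an operation corresponds to a subtree of `T` with
root `e` whose set of leaves is enumerated without repetition by `l`, so it is unique if it
exists. -/
inductive Op (T : PlanarTree) : {p : ℕ} → (Fin p → T.E) → T.E → Prop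
  | unit (e : T.E) : Op T (fun _ : Fin 1 => e) e
  | vertex (v : T.V) : Op T (T.inp v) (T.out v)
  | perm {p q : ℕ} {l : Fin p → T.E} {e : T.E} (σ : Fin q ≃ Fin p) (h : Op T l e) : Op T (l ∘ σ) e
  | comp {p q : ℕ} {l : Fin p → T.E} {m : Fin q → T.E} {e : T.E} (hl : Op T l e) (i : Fin p)
      (hm : Op T m (l i)) : Op T (graft l i m) e

/-- The colored operad `Ω(T)` freely generated by the vertices of `T`; its colors are the edges
of `T`, and each of its sets of operations has at most one element. -/
def Omega (T : PlanarTree) : SymmOperad.{0} T.E where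
  Ops l e := PLift (T.Op l e)
  unit e := ⟨Op.unit e⟩
  perm σ h x := ⟨h ▸ Op.perm σ x.down⟩
  comp x i y hd := ⟨Op.comp x.down i (hd ▸ y.down)⟩
  perm_refl _ := rfl
  perm_perm _ _ _ := rfl
  comp_perm _ _ _ _ _ _ := rfl
  unit_comp _ := rfl
  comp_unit _ _ := rfl
  comp_assoc _ _ _ _ _ _ _ := rfl
  comp_parallel _ _ _ _ _ _ _ _ := rfl

/-- The generating operation of `Ω(T)` given by a vertex. -/
def gen (T : PlanarTree) (v : T.V) : T.Omega.Ops (T.inp v) (T.out v) := ⟨Op.vertex v⟩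

/-- The dendroidal category `Ω`: maps `S → T` are maps of colored operads `Ω(S) → Ω(T)`.
They need not preserve planar structures. -/
instance : Category PlanarTree where
  Hom S T := SymmOperad.Hom S.Omega T.Omega
  id T := SymmOperad.Hom.id T.Omega
  comp f g := SymmOperad.Hom.comp g f

/-- `α : S → T` exhibits `S` as the tree `T / e` obtained from `T` by contracting an internal edge
`e`, which connects the vertices `w` (below `e`) and `v` (above `e`): these two vertices are merged
into one. -/
def IsInnerFace {S T : PlanarTree} (α : S ⟶ T) : Prop :=
  ∃ (v w : T.V), T.out v ∈ T.inputs w ∧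
    Function.Injective α.color ∧ Set.range α.color = {e | e ≠ T.out v} ∧
    ∃ φ : S.V ≃ {u : T.V // u ≠ v},
      (∀ u : S.V, α.color (S.out u) = T.out (φ u)) ∧
      (∀ u : S.V, (φ u : T.V) ≠ w → α.color '' S.inputs u = T.inputs (φ u)) ∧
      (∀ u : S.V, (φ u : T.V) = w →
        α.color '' S.inputs u = (T.inputs w \ {T.out v}) ∪ T.inputs v)

/-- `α : S → T` is the inclusion of the tree obtained from `T` by chopping off a vertex `v`
together with a set `A` of edges. -/
def IsChop {S T : PlanarTree} (α : S ⟶ T) (v : T.V) (A : Set T.E) : Prop :=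
  Function.Injective α.color ∧ Set.range α.color = Aᶜ ∧
    ∃ φ : S.V ≃ {u : T.V // u ≠ v},
      (∀ u : S.V, α.color (S.out u) = T.out (φ u)) ∧
      (∀ u : S.V, α.color '' S.inputs u = T.inputs (φ u))

/-- Outer face maps: either `v` is a vertex all of whose inputs are leaves, which is chopped off
together with its inputs, or `v` is the root vertex and all of its inputs except for one are leaves,
and `v` is chopped off together with the root and these leaves. If `T` is a corolla, this yields the
inclusions of its edges `η → T`. -/
def IsOuterFace {S T : PlanarTree} (α : S ⟶ T) : Prop :=
  ∃ v : T.V,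
    ((∀ e ∈ T.inputs v, T.IsLeaf e) ∧ IsChop α v (T.inputs v)) ∨
    (T.out v = T.root ∧ ∃ e₀ ∈ T.inputs v, (∀ e ∈ T.inputs v, e ≠ e₀ → T.IsLeaf e) ∧
      IsChop α v ({T.root} ∪ (T.inputs v \ {e₀})))

/-- The face maps of `Ω`. -/
def faces : MorphismProperty PlanarTree := fun _ _ α => IsInnerFace α ∨ IsOuterFace α

/-- The class of maps of `Ω` generated by isomorphisms and face maps. -/
def inj : MorphismProperty PlanarTree :=
  (MorphismProperty.isomorphisms PlanarTree ⊔ faces).multiplicativeClosure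

instance : inj.IsMultiplicative :=
  inferInstanceAs (MorphismProperty.multiplicativeClosure _).IsMultiplicative

theorem generator_injective {S T : PlanarTree} {α : S ⟶ T}
    (h : (MorphismProperty.isomorphisms PlanarTree ⊔ faces) α) : Function.Injective α.color := by
  rcases h with hf | ⟨_, _, _, hf, _⟩ | ⟨_, ⟨_, hf, _⟩ | ⟨_, _, _, _, hf, _⟩⟩
  · have : IsIso α := hf
    have e : α ≫ inv α = 𝟙 _ := IsIso.hom_inv_id α
    intro a b hab
    have e' : ∀ a, (inv α).color (α.color a) = a := fun a =>
      congrFun (congrArg SymmOperad.Hom.color e) a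
    rw [← e' a, ← e' b, hab]
  · exact hf
  · exact hf
  · exact hf

theorem inj_injective {S T : PlanarTree} {α : S ⟶ T} (h : inj α) : Function.Injective α.color := by
  induction h with
  | of f hf => exact generator_injective hf
  | id x => exact fun a b h => h
  | comp_of f g _ hg ih => exact fun a b hab => ih (generator_injective hg hab)

theorem inp_ne_out (T : PlanarTree) (v : T.V) (i : Fin (T.arity v)) : T.inp v i ≠ T.out v := by
  intro h
  have key : ∀ b, Relation.ReflTransGen
      (fun a b => ∃ (v : T.V) (i : Fin (T.arity v)), T.inp v i = a ∧ T.out v = b) (T.out v) b →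
      b = T.out v := by
    intro b hb
    induction hb with
    | refl => rfl
    | tail _ hbc ih =>
      obtain ⟨v', i', h1, rfl⟩ := hbc
      have h2 := @T.inp_injective ⟨v', i'⟩ ⟨v, i⟩ (by simp only; rw [h1, ih, h])
      rw [(Sigma.mk.inj h2).1]
  exact T.inp_ne_root v i (by rw [h, key _ (T.exists_path _)])

/-- An operation of `Ω(T)` whose output is a leaf is a unit. -/
theorem Op.of_isLeaf {T : PlanarTree} {p : ℕ} {l : Fin p → T.E} {e : T.E} (h : T.Op l e)
    (he : T.IsLeaf e) : p = 1 ∧ ∀ k, l k = e := by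
  induction h with
  | unit e => exact ⟨rfl, fun _ => rfl⟩
  | vertex v => exact absurd rfl (he v)
  | perm σ _ ih =>
    obtain ⟨h1, h2⟩ := ih he
    exact ⟨by rw [← h1]; simpa using Fintype.card_congr σ, fun k => h2 _⟩
  | comp _ i _ ih1 ih2 =>
    obtain ⟨rfl, h2⟩ := ih1 he
    obtain ⟨rfl, h4⟩ := ih2 (by rw [h2]; exact he)
    refine ⟨rfl, fun k => ?_⟩
    rw [graft_apply]
    split_ifs
    · exact h2 _
    · rw [h4, h2]
    · exact h2 _

/-- A map in `Ω_inj` sends edges that are not leaves to edges that are not leaves. -/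
theorem not_isLeaf_of_inj {S T : PlanarTree} {α : S ⟶ T} (h : inj α) {e : S.E} (he : ¬ S.IsLeaf e) :
    ¬ T.IsLeaf (α.color e) := by
  intro hl
  simp only [IsLeaf, not_forall, not_not] at he
  obtain ⟨v, rfl⟩ := he
  obtain ⟨h1, h2⟩ := Op.of_isLeaf (α.map (S.gen v)).down hl
  have h3 := inj_injective h (h2 ⟨0, by omega⟩)
  exact S.inp_ne_out v _ h3

end PlanarTree

/-- The category `Ω_inj`: the wide subcategory of `Ω` generated by isomorphisms and face maps. -/
abbrev OmegaInj := WideSubcategory PlanarTree.inj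

/-- A semi-dendroidal space is a space-valued presheaf on `Ω_inj`. -/
abbrev SemiDendroidalSpace := OmegaInjᵒᵖ ⥤ TopCat.{u}


/-! ### Topological operads and shifts -/

/-- A colored symmetric operad in topological spaces. -/
structure TopOperad (C : Type v) extends SymmOperad.{u} C where
  top : {p : ℕ} → (l : Fin p → C) → (c : C) → TopologicalSpace (Ops l c)
  continuous_perm : ∀ {p q : ℕ} {l : Fin p → C} {c : C} (σ : Fin q ≃ Fin p),
    Continuous (perm σ rfl : Ops l c → Ops (l ∘ σ) c)
  continuous_comp : ∀ {p q : ℕ} {l : Fin p → C} {m : Fin q → C} {c d : C} (i : Fin p)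
    (hd : d = l i),
    Continuous fun xy : Ops l c × Ops m d => (comp xy.1 i xy.2 hd : Ops (graft l i m) c)

attribute [instance] TopOperad.top

section WeakEquivalence

open scoped Topology.Homotopy

variable {X Y : Type u} [TopologicalSpace X] [TopologicalSpace Y]

/-- The map on `π₀` (path components) induced by a continuous map. -/
def mapPiZero (f : C(X, Y)) : ZerothHomotopy X → ZerothHomotopy Y :=
  Quotient.map f fun _ _ h => h.map f.continuous

/-- The map on `πₙ` induced by a continuous map. -/
def mapPi (f : C(X, Y)) (n : ℕ) (x : X) :
    HomotopyGroup (Fin n) X x → HomotopyGroup (Fin n) Y (f x) :=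
  Quotient.map
    (fun γ : GenLoop (Fin n) X x =>
      (⟨f.comp γ.1, fun y hy => congrArg f (γ.2 y hy)⟩ : GenLoop (Fin n) Y (f x)))
    fun _ _ h => h.map fun H => H.compContinuousMap f

/-- Weak homotopy equivalences: continuous maps inducing bijections on path components and on all
homotopy groups with respect to all base points. -/
def IsWeakHomotopyEquiv (f : X → Y) : Prop :=
  ∃ hf : Continuous f, Function.Bijective (mapPiZero ⟨f, hf⟩) ∧
    ∀ (n : ℕ), 1 ≤ n → ∀ x : X, Function.Bijective (mapPi ⟨f, hf⟩ n x)

end WeakEquivalence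

/-- The set of colors `{1, 2}`. -/
inductive Color : Type
  | one
  | two

/-- The partial order on colors with `1 < 2`. Lists of a fixed length are compared entrywise. -/
instance : PartialOrder Color :=
  PartialOrder.lift (fun c : Color => match c with | .one => (1 : ℕ) | .two => 2)
    (by rintro (_ | _) (_ | _) h <;> simp_all)

theorem Color.le_two (c : Color) : c ≤ .two := by
  cases c
  · exact (show (1 : ℕ) ≤ 2 by norm_num)
  · exact le_rfl

theorem Color.eq_two_of_le {c : Color} (h : .two ≤ c) : c = .two := by
  cases c
  · exact absurd (show (2 : ℕ) ≤ 1 from h) (by norm_num)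
  · rfl

theorem graft_mono {p q : ℕ} {l l' : Fin p → Color} {m m' : Fin q → Color} (hl : l ≤ l')
    (i : Fin p) (hm : m ≤ m') : graft l i m ≤ graft l' i m' := by
  intro k
  simp only [graft]
  rcases slot i q k with x | x
  · exact hl _
  · exact hm _

/-- A (`2`-colored topological) operad with shifts. -/
structure ShiftOperad extends TopOperad.{u} Color where
  /-- `𝒪(2; 2)` is a point (it contains the unit). -/
  subsingleton_two : Subsingleton (Ops (fun _ : Fin 1 => Color.two) .two)
  /-- `𝒪(l; 2)` is empty if `l` is not the one-element list `2`. -/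
  isEmpty_two : ∀ {p : ℕ} (l : Fin p → Color), ¬ (p = 1 ∧ ∀ k, l k = .two) → IsEmpty (Ops l .two)
  /-- The shift map `𝔰_{l,l'} : 𝒪(l; 1) → 𝒪(l'; 1)` for `l ≤ l'`. -/
  shift : {p : ℕ} → {l l' : Fin p → Color} → l ≤ l' → Ops l .one → Ops l' .one
  shift_weakEquiv : ∀ {p : ℕ} {l l' : Fin p → Color} (h : l ≤ l'),
    @IsWeakHomotopyEquiv _ _ (top l .one) (top l' .one) (shift h)
  shift_shift : ∀ {p : ℕ} {l l' l'' : Fin p → Color} (h : l ≤ l') (h' : l' ≤ l'')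
    (x : Ops l .one), shift h' (shift h x) = shift (h.trans h') x
  shift_refl : ∀ {p : ℕ} {l : Fin p → Color} (x : Ops l .one), shift le_rfl x = x
  comp_shift : ∀ {p q : ℕ} {l l' : Fin p → Color} {m m' : Fin q → Color} (hl : l ≤ l')
    (hm : m ≤ m') (x : Ops l .one) (i : Fin p) (hi : .one = l i) (hi' : .one = l' i)
    (y : Ops m .one),
    comp (shift hl x) i (shift hm y) hi' = shift (graft_mono hl i hm) (comp x i y hi)
  perm_shift : ∀ {p : ℕ} {l l' : Fin p → Color} (h : l ≤ l') (σ : Equiv.Perm (Fin p))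
    (x : Ops l .one),
    perm (l' := l' ∘ σ) σ rfl (shift h x) =
      shift (l := l ∘ σ) (fun k => h (σ k)) (perm σ rfl x)

namespace ShiftOperad

/-! ### The dendroidal nerve and the maps `𝔰_T` -/

/-- The points of the dendroidal nerve `N_d(𝒪)_T = Oper(Ω(T), 𝒪)`. -/
def Nerve (O : ShiftOperad.{u}) (T : PlanarTree) : Type u :=
  SymmOperad.Hom T.Omega O.toSymmOperad

/-- The pair `(f₀, f₁)` corresponding to a point of the nerve: a function `f₀` on edges and a
family `f₁` of operations indexed by the vertices. -/
def toPair (O : ShiftOperad.{u}) (T : PlanarTree) (f : O.Nerve T) :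
    (f₀ : T.E → Color) × ((v : T.V) → O.Ops (f₀ ∘ T.inp v) (f₀ (T.out v))) :=
  ⟨f.color, fun v => f.map (T.gen v)⟩

/-- The space `N_d(𝒪)_T` is topologized through `(f₀, f₁)`, as the disjoint union over all `f₀` of
the products over all vertices of the spaces of operations. -/
instance (O : ShiftOperad.{u}) (T : PlanarTree) : TopologicalSpace (O.Nerve T) :=
  TopologicalSpace.induced (O.toPair T) inferInstance

/-- The operator `α^* : N_d(𝒪)_T → N_d(𝒪)_S` of the nerve. -/
def pullback (O : ShiftOperad.{u}) {S T : PlanarTree} (α : S ⟶ T) (f : O.Nerve T) : O.Nerve S :=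
  SymmOperad.Hom.comp f α

theorem subsingleton_ops_two (O : ShiftOperad.{u}) {p : ℕ} (l : Fin p → Color) :
    Subsingleton (O.Ops l .two) := by
  by_cases h : p = 1 ∧ ∀ k, l k = .two
  · obtain ⟨rfl, h⟩ := h
    obtain rfl : l = fun _ => .two := funext h
    exact O.subsingleton_two
  · have := O.isEmpty_two l h
    infer_instance

/-- The unique point of `𝒪(2; 2)`. -/
def point (O : ShiftOperad.{u}) {p : ℕ} {l : Fin p → Color} (h : p = 1 ∧ ∀ k, l k = .two) :
    O.Ops l .two :=
  O.perm (l := fun _ : Fin 1 => Color.two) (finCongr h.1) (funext h.2) (O.unit .two)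

/-- The shift maps, extended to operations with output color `2`: if the new output color `c'` is
`1`, this is `𝔰_{l,l'}`; if `c'` is `2`, then its value is the unique point of `𝒪(2; 2)`. -/
def shiftTo (O : ShiftOperad.{u}) {p : ℕ} {l l' : Fin p → Color} {c : Color} :
    (c' : Color) → l ≤ l' → (c' = .one → c = .one) → (c' = .two → p = 1 ∧ ∀ k, l' k = .two) →
      O.Ops l c → O.Ops l' c'
  | .one, hl, h₁, _, x => O.shift hl (h₁ rfl ▸ x)
  | .two, _, _, h₂, _ => O.point (h₂ rfl)

theorem shiftTo_one (O : ShiftOperad.{u}) {p : ℕ} {l l' : Fin p → Color} (hl : l ≤ l')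
    (h₁ : Color.one = .one → Color.one = .one)
    (h₂ : Color.one = .two → p = 1 ∧ ∀ k, l' k = .two) (x : O.Ops l .one) :
    O.shiftTo .one hl h₁ h₂ x = O.shift hl x := rfl

theorem shiftTo_heq (O : ShiftOperad.{u}) {p : ℕ} {l l' : Fin p → Color} {c c' : Color}
    (hl : l ≤ l') (h₁ : c' = .one → c = .one) (h₂ : c' = .two → p = 1 ∧ ∀ k, l' k = .two)
    (hc' : c' = .one) (hc : c = .one) (x : O.Ops l c) :
    HEq (O.shiftTo c' hl h₁ h₂ x) (O.shift hl (hc ▸ x)) := by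
  subst hc hc'
  rfl

theorem shiftTo_unit (O : ShiftOperad.{u}) {c c' : Color}
    (hl : (fun _ : Fin 1 => c) ≤ fun _ => c') (h₁ : c' = .one → c = .one)
    (h₂ : c' = .two → 1 = 1 ∧ ∀ k : Fin 1, (fun _ : Fin 1 => c') k = .two) :
    O.shiftTo c' hl h₁ h₂ (O.unit c) = O.unit c' := by
  cases c' with
  | one =>
    obtain rfl := h₁ rfl
    exact O.shift_refl _
  | two => exact (O.subsingleton_ops_two _).elim _ _

theorem shiftTo_perm (O : ShiftOperad.{u}) {p q : ℕ} {l l' : Fin p → Color}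
    {m m' : Fin q → Color} {c c' : Color} (σ : Fin q ≃ Fin p) (hm : m = l ∘ σ)
    (hm' : m' = l' ∘ σ) (hl : l ≤ l') (hmm : m ≤ m') (h₁ : c' = .one → c = .one)
    (h₂ : c' = .two → p = 1 ∧ ∀ k, l' k = .two) (h₂' : c' = .two → q = 1 ∧ ∀ k, m' k = .two)
    (x : O.Ops l c) :
    O.shiftTo c' hmm h₁ h₂' (O.perm σ hm x) = O.perm σ hm' (O.shiftTo c' hl h₁ h₂ x) := by
  obtain rfl : q = p := by simpa using Fintype.card_congr σ
  subst hm hm'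
  cases c' with
  | one =>
    obtain rfl := h₁ rfl
    exact (O.perm_shift hl σ x).symm
  | two => exact (O.subsingleton_ops_two _).elim _ _

/-- `x` is a unit, up to the identification of its list of inputs with a one-element list. -/
def IsUnitLike (O : ShiftOperad.{u}) {p : ℕ} {l : Fin p → Color} {c : Color} (x : O.Ops l c) :
    Prop :=
  ∃ (h : p = 1) (h' : l = (fun _ => c) ∘ finCongr h), x = O.perm (finCongr h) h' (O.unit c)

theorem isUnitLike_of_eq_two (O : ShiftOperad.{u}) {p : ℕ} {l : Fin p → Color} {c : Color}
    (x : O.Ops l c) (hc : c = .two) : O.IsUnitLike x := by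
  subst hc
  by_cases h : p = 1 ∧ ∀ k, l k = .two
  · exact ⟨h.1, funext fun k => h.2 k, (O.subsingleton_ops_two _).elim _ _⟩
  · exact ((O.isEmpty_two l h).false x).elim

theorem comp_unitLike_eq {O : ShiftOperad.{u}} {p : ℕ} {l : Fin p → Color} {c d : Color}
    (x : O.Ops l c) (i : Fin p) (hd : d = l i) {q : ℕ} {m : Fin q → Color} (h : q = 1)
    (h' : m = (fun _ => d) ∘ finCongr h) :
    ∃ h'' : graft l i m = l ∘ ((blockEquiv (Equiv.refl (Fin p)) i (finCongr h)).trans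
        (finCongr (Nat.sub_add_cancel i.pos))),
      O.comp x i (O.perm (finCongr h) h' (O.unit d)) hd =
        O.perm ((blockEquiv (Equiv.refl (Fin p)) i (finCongr h)).trans
          (finCongr (Nat.sub_add_cancel i.pos))) h'' x := by
  subst hd h'
  have h1 := O.comp_perm (Equiv.refl (Fin p)) (finCongr h) x i (O.unit (l i)) rfl
  have h2 := O.comp_unit x i
  simp only [Equiv.refl_apply] at h1
  have h3 := O.perm_refl x
  refine ⟨?_, ?_⟩
  · have := graft_blockEquiv (Equiv.refl (Fin p)) i (finCongr h) l (fun _ => l i)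
    refine this.trans ?_
    have h4 := graft_unit_right l i
    simp only [Equiv.refl_apply]
    rw [h4]
    rfl
  · have h5 : O.comp x i (O.perm (finCongr h) rfl (O.unit (l i))) rfl =
        O.comp (O.perm (Equiv.refl (Fin p)) rfl x) i (O.perm (finCongr h) rfl (O.unit (l i)))
          rfl := by rw [h3]; rfl
    refine h5.trans (h1.trans ?_)
    rw [h2]
    exact O.perm_perm' _ _ _ _ _

theorem shiftTo_comp (O : ShiftOperad.{u}) {p q : ℕ} {l l' : Fin p → Color}
    {m m' : Fin q → Color} {c c' d d' : Color} (hl : l ≤ l') (hm : m ≤ m') (i : Fin p)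
    (h₁ : c' = .one → c = .one) (h₂ : c' = .two → p = 1 ∧ ∀ k, l' k = .two)
    (k₁ : d' = .one → d = .one) (k₂ : d' = .two → q = 1 ∧ ∀ k, m' k = .two)
    (h₂' : c' = .two → p - 1 + q = 1 ∧ ∀ k, graft l' i m' k = .two)
    (hd : d = l i) (hd' : d' = l' i) (x : O.Ops l c) (y : O.Ops m d)
    (hy : d' = .two → O.IsUnitLike y) :
    O.shiftTo c' (graft_mono hl i hm) h₁ h₂' (O.comp x i y hd) =
      O.comp (O.shiftTo c' hl h₁ h₂ x) i (O.shiftTo d' hm k₁ k₂ y) hd' := by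
  cases c' with
  | two => exact (O.subsingleton_ops_two _).elim _ _
  | one =>
    obtain rfl := h₁ rfl
    cases d' with
    | one =>
      obtain rfl := k₁ rfl
      exact (O.comp_shift hl hm x i hd hd' y).symm
    | two =>
      obtain ⟨h, h', rfl⟩ := hy rfl
      obtain ⟨e₁, e₂⟩ := comp_unitLike_eq x i hd h h'
      obtain ⟨e₃, e₄⟩ := comp_unitLike_eq (O.shift hl x) i hd' h (funext (k₂ rfl).2)
      rw [e₂]
      refine Eq.trans ?_ e₄.symm
      exact O.shiftTo_perm _ e₁ e₃ hl _ h₁ h₂ h₂' x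

open Classical in
/-- The new function on colors `f₀'`: leaves are sent to `2`, and `f₀'(e) = f₀(e)` otherwise. -/
noncomputable def leafColor (T : PlanarTree) (f₀ : T.E → Color) (e : T.E) : Color :=
  if T.IsLeaf e then .two else f₀ e

theorem le_leafColor (T : PlanarTree) (f₀ : T.E → Color) : f₀ ≤ leafColor T f₀ := by
  intro e
  unfold leafColor
  split_ifs
  · exact Color.le_two _
  · exact le_rfl

theorem of_leafColor_eq_one {T : PlanarTree} {f₀ : T.E → Color} {e : T.E}
    (h : leafColor T f₀ e = .one) : f₀ e = .one := by
  unfold leafColor at h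
  split_ifs at h
  exact h

theorem isUnitLike_of_leafColor (O : ShiftOperad.{u}) {T : PlanarTree} (f : O.Nerve T) {p : ℕ}
    {l : Fin p → T.E} {e : T.E} (x : T.Omega.Ops l e) (h : leafColor T f.color e = .two) :
    O.IsUnitLike (f.map x) := by
  by_cases he : T.IsLeaf e
  · obtain ⟨rfl, h'⟩ := x.down.of_isLeaf he
    obtain rfl : l = fun _ => e := funext h'
    have : f.map x = O.unit (f.color e) := f.map_unit e
    rw [this]
    exact ⟨rfl, rfl, (O.perm_refl _).symm⟩
  · rw [leafColor, if_neg he] at h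
    exact O.isUnitLike_of_eq_two _ h

theorem profile_of_leafColor (O : ShiftOperad.{u}) {T : PlanarTree} (f : O.Nerve T) {p : ℕ}
    {l : Fin p → T.E} {e : T.E} (x : T.Omega.Ops l e) (h : leafColor T f.color e = .two) :
    p = 1 ∧ ∀ k, (leafColor T f.color ∘ l) k = .two := by
  obtain ⟨hp, hl, _⟩ := O.isUnitLike_of_leafColor f x h
  refine ⟨hp, fun k => ?_⟩
  by_cases he : T.IsLeaf e
  · rw [Function.comp_apply, (x.down.of_isLeaf he).2 k, h]
  · rw [leafColor, if_neg he] at h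
    have h1 : f.color (l k) = .two := (congrFun hl k).trans h
    exact Color.eq_two_of_le (h1 ▸ le_leafColor T f.color (l k))

/-- The map `𝔰_T(f₀, f₁) = (f₀', f₁')`: `f₀'` sends leaves to `2` and agrees with `f₀` on all other
edges, and `f₁'(v) = 𝔰_{l,l'} f₁(v)` for every vertex `v`, where `l` and `l'` are the lists of
colors of the inputs of `v` under `f₀` and `f₀'`. The definition gives the values of the operad map
`𝔰_T(f₀, f₁)` on all operations of `Ω(T)`; see `shiftNerve_gen` and `toPair_injective`. -/
noncomputable def shiftNerve (O : ShiftOperad.{u}) (T : PlanarTree) (f : O.Nerve T) : O.Nerve T where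
  color := leafColor T f.color
  map {_ l e} x :=
    O.shiftTo (leafColor T f.color e) (fun k => le_leafColor T f.color (l k)) of_leafColor_eq_one
      (O.profile_of_leafColor f x) (f.map x)
  map_unit e := by
    have h : f.map (T.Omega.unit e) = O.unit (f.color e) := f.map_unit e
    rw [h]
    exact O.shiftTo_unit (fun _ => le_leafColor T f.color e) _
      (fun h => ⟨rfl, fun _ => h⟩)
  map_perm {p q l e} σ x := by
    rw [f.map_perm]
    exact O.shiftTo_perm (l := f.color ∘ l) (l' := leafColor T f.color ∘ l) σ rfl rfl
      (fun k => le_leafColor T f.color (l k)) _ _ _ _ _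
  map_comp {p q l m c d} x i y hd := by
    have key := O.shiftTo_comp (l := f.color ∘ l) (l' := leafColor T f.color ∘ l)
      (m := f.color ∘ m) (m' := leafColor T f.color ∘ m) (c := f.color c)
      (c' := leafColor T f.color c) (d' := leafColor T f.color d)
      (fun k => le_leafColor T f.color (l k)) (fun k => le_leafColor T f.color (m k)) i
      of_leafColor_eq_one (O.profile_of_leafColor f x) of_leafColor_eq_one
      (O.profile_of_leafColor f y)
      (by
        rw [← comp_graft]
        exact O.profile_of_leafColor f (T.Omega.comp x i y hd))
      (congrArg f.color hd) (congrArg (leafColor T f.color) hd) (f.map x) (f.map y)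
      (O.isUnitLike_of_leafColor f y)
    rw [f.map_comp, ← key]
    exact O.shiftTo_perm _ _ _ _ _ _ _ _ _

/-- The value of `𝔰_T(f₀, f₁)` at a vertex `v`. -/
theorem shiftNerve_gen (O : ShiftOperad.{u}) (T : PlanarTree) (f : O.Nerve T) (v : T.V)
    (hv : f.color (T.out v) = .one) :
    HEq ((O.shiftNerve T f).map (T.gen v))
      (O.shift (l := f.color ∘ T.inp v) (l' := leafColor T f.color ∘ T.inp v)
        (fun k => le_leafColor T f.color (T.inp v k)) (hv ▸ f.map (T.gen v))) := by
  have h : ¬ T.IsLeaf (T.out v) := fun h => h v rfl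
  exact O.shiftTo_heq _ _ _ (if_neg h |>.trans hv) hv _

/-- An operad map `Ω(T) → 𝒪` is determined by the corresponding pair `(f₀, f₁)`. -/
theorem toPair_injective (O : ShiftOperad.{u}) (T : PlanarTree) :
    Function.Injective (O.toPair T) := by
  rintro ⟨cf, mf, f₁, f₂, f₃⟩ ⟨cg, mg, g₁, g₂, g₃⟩ h
  simp only [toPair, Sigma.mk.injEq] at h
  obtain ⟨rfl, h⟩ := h
  have hv : ∀ v, mf (T.gen v) = mg (T.gen v) := fun v => congrFun (eq_of_heq h) v
  have key : ∀ {p : ℕ} {l : Fin p → T.E} {e : T.E} (x : T.Op l e),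
      mf (p := p) (l := l) (c := e) ⟨x⟩ = mg ⟨x⟩ := by
    intro p l e x
    induction x with
    | unit e => exact (f₁ e).trans (g₁ e).symm
    | vertex v => exact hv v
    | perm σ x ih => exact (f₂ σ ⟨x⟩).trans ((congrArg _ ih).trans (g₂ σ ⟨x⟩).symm)
    | comp x i y ihx ihy =>
      refine (f₃ ⟨x⟩ i ⟨y⟩ rfl).trans (Eq.trans ?_ (g₃ ⟨x⟩ i ⟨y⟩ rfl).symm)
      rw [ihx, ihy]
  have : @mf = @mg := by
    funext p l e x
    exact key x.down
  subst this
  rfl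

/-! ### The spaces `X_T` and the operators `α̂` -/

/-- The space `X_T^L ⊆ N_d(𝒪)_T` of operad maps sending all leaves to `2`. -/
def XL (O : ShiftOperad.{u}) (T : PlanarTree) : Type u :=
  {f : O.Nerve T // ∀ e, T.IsLeaf e → f.color e = .two}

/-- The space `X_T ⊆ N_d(𝒪)_T` for `T ≠ η`: operad maps sending all leaves to `2`, and sending the
root and all internal edges to `1`. -/
def XSub (O : ShiftOperad.{u}) (T : PlanarTree) : Type u :=
  {f : O.Nerve T // (∀ e, T.IsLeaf e → f.color e = .two) ∧ f.color T.root = .one ∧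
    ∀ e, T.IsInternal e → f.color e = .one}

instance (O : ShiftOperad.{u}) (T : PlanarTree) : TopologicalSpace (O.XL T) :=
  instTopologicalSpaceSubtype

instance (O : ShiftOperad.{u}) (T : PlanarTree) : TopologicalSpace (O.XSub T) :=
  instTopologicalSpaceSubtype

/-- The map `𝔰_T : N_d(𝒪)_T → X_T^L`. -/
noncomputable def shiftL (O : ShiftOperad.{u}) (T : PlanarTree) (f : O.Nerve T) : O.XL T :=
  ⟨O.shiftNerve T f, fun _ he => if_pos he⟩

/-- The space `X_T`: it is `XSub O T` for `T ≠ η`, and it is a point for `T = η` (as a product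
indexed by the proofs of `T ≠ η`, i.e. by a one-element set if `T ≠ η` and by the empty set if
`T = η`). -/
def X (O : ShiftOperad.{u}) (T : PlanarTree) : Type u := PLift (¬ T.IsEta) → O.XSub T

instance (O : ShiftOperad.{u}) (T : PlanarTree) : TopologicalSpace (O.X T) :=
  inferInstanceAs (TopologicalSpace (PLift (¬ T.IsEta) → O.XSub T))

/-- `X_η` is a point. -/
@[reducible]
def uniqueXOfIsEta (O : ShiftOperad.{u}) {T : PlanarTree} (h : T.IsEta) : Unique (O.X T) where
  default := fun h' => (h'.down h).elim
  uniq _ := funext fun h' => (h'.down h).elim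

/-- `X_T` is the indicated subspace of the nerve if `T ≠ η`. -/
def homeoXOfNotIsEta (O : ShiftOperad.{u}) {T : PlanarTree} (h : ¬ T.IsEta) :
    O.X T ≃ₜ O.XSub T where
  toFun x := x ⟨h⟩
  invFun x := fun _ => x
  left_inv _ := rfl
  right_inv _ := rfl
  continuous_toFun := continuous_apply (PLift.up h)
  continuous_invFun := continuous_pi fun _ => continuous_id

theorem not_isEta_of_hom {S T : OmegaInj} (α : S ⟶ T) (hS : ¬ S.obj.IsEta) : ¬ T.obj.IsEta := by
  intro hT
  have : IsEmpty T.obj.V := hT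
  obtain ⟨v⟩ := not_isEmpty_iff.mp hS
  exact PlanarTree.not_isLeaf_of_inj α.property (e := S.obj.out v) (fun h => h v rfl)
    (fun w => isEmptyElim w)

theorem not_isLeaf_root {T : PlanarTree} (h : ¬ T.IsEta) : ¬ T.IsLeaf T.root := by
  obtain ⟨v⟩ := not_isEmpty_iff.mp h
  rcases Relation.ReflTransGen.cases_tail (T.exists_path (T.out v)) with h | ⟨_, _, w, _, _, h⟩
  · exact fun h' => h' v h.symm
  · exact fun h' => h' w h

/-- For `α` in `Ω_inj`, the map `𝔰_S ∘ α^*` sends `X_T` into `X_S` (if `S ≠ η`). -/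
theorem shiftL_pullback_mem (O : ShiftOperad.{u}) {S T : OmegaInj} (α : S ⟶ T)
    (hS : ¬ S.obj.IsEta) (f : O.XSub T.obj) :
    (O.shiftL S.obj (O.pullback α.hom f.1)).1.color S.obj.root = .one ∧
      ∀ e, S.obj.IsInternal e → (O.shiftL S.obj (O.pullback α.hom f.1)).1.color e = .one := by
  have key : ∀ e, ¬ S.obj.IsLeaf e →
      (O.shiftL S.obj (O.pullback α.hom f.1)).1.color e = .one := by
    intro e he
    have h1 : (O.shiftL S.obj (O.pullback α.hom f.1)).1.color e = f.1.color (α.hom.color e) :=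
      if_neg he
    rw [h1]
    by_cases hr : α.hom.color e = T.obj.root
    · rw [hr]
      exact f.2.2.1
    · exact f.2.2.2 _ ⟨hr, PlanarTree.not_isLeaf_of_inj α.property he⟩
  exact ⟨key _ (not_isLeaf_root hS), fun e he => key e he.2⟩

/-- The operator `α̂ : X_T → X_S` for `α : S → T` in `Ω_inj`. If `S ≠ η` it is given by `𝔰_S ∘ α^*`,
and if `S = η` it is the unique map to the point. -/
noncomputable def hat (O : ShiftOperad.{u}) {S T : OmegaInj} (α : S ⟶ T) (x : O.X T.obj) :
    O.X S.obj := fun hS =>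
  let y : O.XL S.obj := O.shiftL S.obj (O.pullback α.hom (x ⟨not_isEta_of_hom α hS.down⟩).1)
  ⟨y.1, y.2, O.shiftL_pullback_mem α hS.down _⟩

end ShiftOperad

end Dendroidal

/-!
The operator `α̂` is built from `𝔰_S ∘ α^*`, and two facts make it functorial. For `f ∈ X_T` the
coloring already is `2` on leaves, so `𝔰_T f = f` and identities act trivially
(`shiftNerve_eq_self`). For `β : R → S` in `Ω_inj` and `g ∈ N_d(𝒪)_S` one has
`𝔰_R β^* 𝔰_S g = 𝔰_R β^* g` (`shiftNerve_pullback_shiftNerve`): since `β` sends edges that are not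
leaves to edges that are not leaves, the recoloring of the leaves of `S` is only visible on leaves
of `R`, where it is overwritten by `𝔰_R`; on operations this is `𝔰_{l',l''} 𝔰_{l,l'} = 𝔰_{l,l''}`,
and nothing has to be checked for operations with output color `2`, as they are unique.

For continuity, the nerve is a disjoint union over colorings, so a map into it is continuous as
soon as the coloring is locally constant and every vertex component is continuous
(`continuous_sigmaMk_pi`). The value of an operad map on any operation of `Ω(T)` depends
continuously on the values at the vertices (`continuous_eval`), by induction on the way the
operation is generated. This gives the continuity of `α^*`, and that of `𝔰_T` follows from the
continuity of the shift maps.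
-/

/-! ### Continuous maps into disjoint unions -/

namespace Dendroidal

section Sigma

variable {Z I : Type*} [TopologicalSpace Z]

theorem isLocallyConstant_of_continuous_sigmaMk {A : I → Type*} [∀ i, TopologicalSpace (A i)]
    {c : Z → I} {g : ∀ z, A (c z)} (h : Continuous fun z => (⟨c z, g z⟩ : Σ i, A i)) :
    IsLocallyConstant c := by
  intro s
  exact (isOpen_sigma_fst_preimage s).preimage h

/-- A map into a disjoint union is continuous if and only if its index is locally constant and its
restrictions to the fibers of the index are continuous. -/
theorem continuous_sigmaMk_iff {A : I → Type*} [∀ i, TopologicalSpace (A i)]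
    {c : Z → I} (hc : IsLocallyConstant c) {g : ∀ z, A (c z)} :
    (Continuous fun z => (⟨c z, g z⟩ : Σ i, A i)) ↔
      ∀ i, Continuous fun z : {z // c z = i} => (z.2 ▸ g z.1 : A i) := by
  have key : ∀ i, (Continuous fun z : {z // c z = i} => (z.2 ▸ g z.1 : A i)) ↔
      Continuous fun z : {z // c z = i} => (⟨c z.1, g z.1⟩ : Σ i, A i) := by
    intro i
    rw [Topology.IsInducing.continuous_iff (Topology.IsEmbedding.sigmaMk (i := i)).isInducing]
    refine iff_of_eq (congrArg Continuous (funext ?_))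
    rintro ⟨z, rfl⟩
    rfl
  simp only [key]
  refine ⟨fun h i => h.comp continuous_subtype_val, fun h => ?_⟩
  rw [continuous_iff_continuousAt]
  intro z
  exact ((hc.isOpen_fiber (c z)).isOpenEmbedding_subtypeVal.continuousAt_iff
    (x := ⟨z, rfl⟩)).1 (h (c z)).continuousAt

theorem continuous_sigmaMk_pi {J : Type*} {A : J → I → Type*} [∀ j i, TopologicalSpace (A j i)]
    {c : Z → I} (hc : IsLocallyConstant c) {g : ∀ z j, A j (c z)}
    (h : ∀ j, Continuous fun z => (⟨c z, g z j⟩ : Σ i, A j i)) :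
    Continuous fun z => (⟨c z, g z⟩ : Σ i, ∀ j, A j i) := by
  rw [continuous_sigmaMk_iff hc]
  intro i
  refine continuous_pi fun j => ?_
  refine ((continuous_sigmaMk_iff hc).1 (h j) i).congr ?_
  rintro ⟨z, rfl⟩
  rfl

theorem continuous_sigmaMk_prod {A B : I → Type*} [∀ i, TopologicalSpace (A i)]
    [∀ i, TopologicalSpace (B i)] {c : Z → I} {a : ∀ z, A (c z)} {b : ∀ z, B (c z)}
    (ha : Continuous fun z => (⟨c z, a z⟩ : Σ i, A i))
    (hb : Continuous fun z => (⟨c z, b z⟩ : Σ i, B i)) :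
    Continuous fun z => (⟨c z, a z, b z⟩ : Σ i, A i × B i) := by
  have hc := isLocallyConstant_of_continuous_sigmaMk ha
  rw [continuous_sigmaMk_iff hc]
  intro i
  refine (((continuous_sigmaMk_iff hc).1 ha i).prodMk
    ((continuous_sigmaMk_iff hc).1 hb i)).congr ?_
  rintro ⟨z, rfl⟩
  rfl

end Sigma

namespace ShiftOperad

/-! ### Continuity of the operators of the nerve -/

theorem continuous_toPair (O : ShiftOperad.{u}) (T : PlanarTree) : Continuous (O.toPair T) :=
  continuous_induced_dom

theorem isLocallyConstant_color (O : ShiftOperad.{u}) (T : PlanarTree) :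
    IsLocallyConstant fun f : O.Nerve T => f.color :=
  isLocallyConstant_of_continuous_sigmaMk (O.continuous_toPair T)

theorem continuous_perm' (O : ShiftOperad.{u}) {p q : ℕ} {l : Fin p → Color} {l' : Fin q → Color}
    {c : Color} (σ : Fin q ≃ Fin p) (h : l' = l ∘ σ) :
    Continuous (O.perm σ h : O.Ops l c → O.Ops l' c) := by
  subst h
  exact O.continuous_perm σ

/-- Evaluation at an operation of `Ω(T)` is continuous on the nerve. The coloring is recorded as
well, since the space of operations in which the value lies depends on it. -/
theorem continuous_eval (O : ShiftOperad.{u}) (T : PlanarTree) {p : ℕ} {l : Fin p → T.E} {e : T.E}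
    (x : T.Op l e) :
    Continuous fun f : O.Nerve T =>
      (⟨f.color, f.map (p := p) (l := l) (c := e) ⟨x⟩⟩ :
        Σ f₀ : T.E → Color, O.Ops (f₀ ∘ l) (f₀ e)) := by
  induction x with
  | unit e =>
    have h : Continuous fun y : (Σ f₀ : T.E → Color, ((v : T.V) → O.Ops (f₀ ∘ T.inp v)
        (f₀ (T.out v)))) =>
          (⟨y.1, O.unit (y.1 e)⟩ : Σ f₀ : T.E → Color, O.Ops (f₀ ∘ fun _ : Fin 1 => e) (f₀ e)) :=
      Continuous.sigma_map
        (τ := fun f₀ : T.E → Color => O.Ops (f₀ ∘ fun _ : Fin 1 => e) (f₀ e))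
        (f₁ := id) (f₂ := fun f₀ _ => O.unit (f₀ e)) fun _ => continuous_const
    exact (h.comp (O.continuous_toPair T)).congr fun f =>
      congrArg (Sigma.mk f.color) (f.map_unit e).symm
  | vertex v =>
    have h : Continuous fun y : (Σ f₀ : T.E → Color, ((v : T.V) → O.Ops (f₀ ∘ T.inp v)
        (f₀ (T.out v)))) =>
          (⟨y.1, y.2 v⟩ : Σ f₀ : T.E → Color, O.Ops (f₀ ∘ T.inp v) (f₀ (T.out v))) :=
      continuous_sigma fun _ => continuous_sigmaMk.comp (continuous_apply v)
    exact h.comp (O.continuous_toPair T)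
  | @perm p q l e σ x ih =>
    have h : Continuous fun y : (Σ f₀ : T.E → Color, O.Ops (f₀ ∘ l) (f₀ e)) =>
        (⟨y.1, O.perm σ rfl y.2⟩ : Σ f₀ : T.E → Color, O.Ops (f₀ ∘ (l ∘ σ)) (f₀ e)) :=
      continuous_sigma fun _ => continuous_sigmaMk.comp (O.continuous_perm σ)
    exact (h.comp ih).congr fun f => congrArg (Sigma.mk f.color) (f.map_perm σ ⟨x⟩).symm
  | @comp p q l m e x i y ihx ihy =>
    have h : Continuous fun z : (Σ f₀ : T.E → Color,
        O.Ops (f₀ ∘ l) (f₀ e) × O.Ops (f₀ ∘ m) (f₀ (l i))) =>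
          (⟨z.1, O.perm (Equiv.refl _) (comp_graft' z.1 l i m) (O.comp z.2.1 i z.2.2 rfl)⟩ :
            Σ f₀ : T.E → Color, O.Ops (f₀ ∘ graft l i m) (f₀ e)) :=
      Continuous.sigma_map
        (σ := fun f₀ : T.E → Color => O.Ops (f₀ ∘ l) (f₀ e) × O.Ops (f₀ ∘ m) (f₀ (l i)))
        (τ := fun f₀ : T.E → Color => O.Ops (f₀ ∘ graft l i m) (f₀ e)) (f₁ := id)
        (f₂ := fun f₀ y => O.perm (Equiv.refl _) (comp_graft' f₀ l i m) (O.comp y.1 i y.2 rfl))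
        fun _ => (O.continuous_perm' _ _).comp (O.continuous_comp i rfl)
    exact (h.comp (continuous_sigmaMk_prod ihx ihy)).congr fun f =>
      congrArg (Sigma.mk f.color) (f.map_comp ⟨x⟩ i ⟨y⟩ rfl).symm

theorem continuous_pullback (O : ShiftOperad.{u}) {S T : PlanarTree} (α : S ⟶ T) :
    Continuous (O.pullback α) := by
  rw [continuous_induced_rng]
  refine continuous_sigmaMk_pi
    (c := fun f : O.Nerve T => (f.color ∘ α.color : S.E → Color))
    (A := fun v (f₀ : S.E → Color) => O.Ops (f₀ ∘ S.inp v) (f₀ (S.out v)))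
    ((O.isLocallyConstant_color T).comp (· ∘ α.color)) fun v => ?_
  have h : Continuous fun y : (Σ f₀ : T.E → Color,
      O.Ops (f₀ ∘ (α.color ∘ S.inp v)) (f₀ (α.color (S.out v)))) =>
        (⟨y.1 ∘ α.color, y.2⟩ : Σ f₀ : S.E → Color, O.Ops (f₀ ∘ S.inp v) (f₀ (S.out v))) :=
    continuous_sigma fun f₀ => continuous_sigmaMk (i := f₀ ∘ α.color)
      (σ := fun f₀ : S.E → Color => O.Ops (f₀ ∘ S.inp v) (f₀ (S.out v)))
  exact h.comp (O.continuous_eval T (α.map (S.gen v)).down)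

theorem continuous_shiftTo (O : ShiftOperad.{u}) {p : ℕ} {l l' : Fin p → Color} {c c' : Color}
    (hl : l ≤ l') (h₁ : c' = .one → c = .one)
    (h₂ : O.Ops l c → c' = .two → p = 1 ∧ ∀ k, l' k = .two) :
    Continuous fun x : O.Ops l c => O.shiftTo c' hl h₁ (h₂ x) x := by
  cases c' with
  | one =>
    obtain rfl := h₁ rfl
    exact (O.shift_weakEquiv hl).1
  | two =>
    have := O.subsingleton_ops_two l'
    exact continuous_of_const fun _ _ => Subsingleton.elim _ _

theorem continuous_shiftNerve (O : ShiftOperad.{u}) (T : PlanarTree) :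
    Continuous (O.shiftNerve T) := by
  rw [continuous_induced_rng]
  refine continuous_sigmaMk_pi (c := fun f : O.Nerve T => leafColor T f.color)
    (A := fun v (f₀ : T.E → Color) => O.Ops (f₀ ∘ T.inp v) (f₀ (T.out v)))
    ((O.isLocallyConstant_color T).comp (leafColor T)) fun v => ?_
  have hv : ¬ T.IsLeaf (T.out v) := fun h => h v rfl
  -- As `out v` is not a leaf, an operation whose new output color is `2` already had output
  -- color `2`, so the new profile is determined by the mere existence of the operation.
  have hp : ∀ f₀ : T.E → Color, O.Ops (f₀ ∘ T.inp v) (f₀ (T.out v)) →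
      leafColor T f₀ (T.out v) = .two →
        T.arity v = 1 ∧ ∀ k, (leafColor T f₀ ∘ T.inp v) k = .two := by
    intro f₀ x h
    rw [leafColor, if_neg hv] at h
    obtain ⟨h1, h2, -⟩ := O.isUnitLike_of_eq_two x h
    refine ⟨h1, fun k => Color.eq_two_of_le ?_⟩
    have h3 : f₀ (T.inp v k) = .two := (congrFun h2 k).trans h
    exact h3 ▸ le_leafColor T f₀ (T.inp v k)
  have h : Continuous fun y : (Σ f₀ : T.E → Color, O.Ops (f₀ ∘ T.inp v) (f₀ (T.out v))) =>
      (⟨leafColor T y.1, O.shiftTo (l := y.1 ∘ T.inp v) (l' := leafColor T y.1 ∘ T.inp v)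
        (leafColor T y.1 (T.out v)) (fun k => le_leafColor T y.1 (T.inp v k))
        of_leafColor_eq_one (hp y.1 y.2) y.2⟩ :
        Σ f₀ : T.E → Color, O.Ops (f₀ ∘ T.inp v) (f₀ (T.out v))) :=
    Continuous.sigma_map (τ := fun f₀ : T.E → Color => O.Ops (f₀ ∘ T.inp v) (f₀ (T.out v)))
      (f₁ := leafColor T)
      (f₂ := fun f₀ x => O.shiftTo (l := f₀ ∘ T.inp v) (l' := leafColor T f₀ ∘ T.inp v)
        (leafColor T f₀ (T.out v)) (fun k => le_leafColor T f₀ (T.inp v k))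
        of_leafColor_eq_one (hp f₀ x) x)
      fun f₀ => O.continuous_shiftTo _ _ (hp f₀)
  exact h.comp (O.continuous_eval T (T.gen v).down)

theorem continuous_hat (O : ShiftOperad.{u}) {S T : OmegaInj} (α : S ⟶ T) :
    Continuous (O.hat α) := by
  refine continuous_pi fun hS => ?_
  refine Continuous.subtype_mk ?_ _
  exact (O.continuous_shiftNerve S.obj).comp ((O.continuous_pullback α.hom).comp
    (continuous_subtype_val.comp
      (continuous_apply (PLift.up (not_isEta_of_hom α hS.down)))))

/-! ### Functoriality -/

theorem nerve_ext (O : ShiftOperad.{u}) {T : PlanarTree} {f g : O.Nerve T}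
    (h₀ : f.color = g.color) (h₁ : ∀ v, HEq (f.map (T.gen v)) (g.map (T.gen v))) : f = g := by
  refine O.toPair_injective T (Sigma.ext h₀ (Function.hfunext rfl ?_))
  rintro v _ ⟨⟩
  exact h₁ v

theorem shiftTo_shiftTo_heq (O : ShiftOperad.{u}) {p : ℕ} {l l' l'' m : Fin p → Color}
    {c c' c'' d : Color} (hm : l'' = m) (hd : c'' = d) (hl : l ≤ l') (hl' : l' ≤ l'') (hlm : l ≤ m)
    (h₁ : c' = .one → c = .one) (h₂ : c' = .two → p = 1 ∧ ∀ k, l' k = .two)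
    (h₁' : c'' = .one → c' = .one) (h₂' : c'' = .two → p = 1 ∧ ∀ k, l'' k = .two)
    (k₁ : d = .one → c = .one) (k₂ : d = .two → p = 1 ∧ ∀ k, m k = .two) (x : O.Ops l c) :
    HEq (O.shiftTo c'' hl' h₁' h₂' (O.shiftTo c' hl h₁ h₂ x)) (O.shiftTo d hlm k₁ k₂ x) := by
  subst hm hd
  cases c'' with
  | one =>
    obtain rfl := h₁' rfl
    obtain rfl := h₁ rfl
    exact heq_of_eq (O.shift_shift hl hl' x)
  | two => exact heq_of_eq ((O.subsingleton_ops_two _).elim _ _)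

theorem shiftTo_self_heq (O : ShiftOperad.{u}) {p : ℕ} {l l' : Fin p → Color} {c c' : Color}
    (hll : l' = l) (hc : c' = c) (hl : l ≤ l') (h₁ : c' = .one → c = .one)
    (h₂ : c' = .two → p = 1 ∧ ∀ k, l' k = .two) (x : O.Ops l c) :
    HEq (O.shiftTo c' hl h₁ h₂ x) x := by
  subst hll hc
  cases c' with
  | one => exact heq_of_eq (O.shift_refl x)
  | two => exact heq_of_eq ((O.subsingleton_ops_two _).elim _ _)

theorem shiftNerve_eq_self (O : ShiftOperad.{u}) {T : PlanarTree} {f : O.Nerve T}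
    (hf : ∀ e, T.IsLeaf e → f.color e = .two) : O.shiftNerve T f = f := by
  have h : leafColor T f.color = f.color := by
    funext e
    unfold leafColor
    split_ifs with he
    · exact (hf e he).symm
    · rfl
  exact O.nerve_ext h fun v =>
    O.shiftTo_self_heq (congrArg (· ∘ T.inp v) h) (congrFun h (T.out v)) _ _ _ _

/-- The recoloring of the leaves of `S` becomes invisible after pulling back along a map `β` of
`Ω_inj` and recoloring the leaves of `R`, because `β` preserves edges that are not leaves. -/
theorem leafColor_comp_leafColor {R S : PlanarTree} {β : R ⟶ S} (hβ : PlanarTree.inj β)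
    (f₀ : S.E → Color) :
    leafColor R (leafColor S f₀ ∘ β.color) = leafColor R (f₀ ∘ β.color) := by
  funext e
  by_cases he : R.IsLeaf e
  · simp only [leafColor, if_pos he]
  · simp only [leafColor, if_neg he, Function.comp,
      if_neg (PlanarTree.not_isLeaf_of_inj hβ he)]

theorem shiftNerve_pullback_shiftNerve (O : ShiftOperad.{u}) {R S : PlanarTree} {β : R ⟶ S}
    (hβ : PlanarTree.inj β) (g : O.Nerve S) :
    O.shiftNerve R (O.pullback β (O.shiftNerve S g)) = O.shiftNerve R (O.pullback β g) := by
  have h := leafColor_comp_leafColor hβ g.color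
  exact O.nerve_ext h fun v =>
    O.shiftTo_shiftTo_heq (congrArg (· ∘ R.inp v) h) (congrFun h (R.out v)) _ _ _ _ _ _ _ _ _ _

theorem hat_id (O : ShiftOperad.{u}) (T : OmegaInj) (x : O.X T.obj) : O.hat (𝟙 T) x = x := by
  funext hT
  exact Subtype.ext (O.shiftNerve_eq_self (x hT).2.1)

theorem hat_comp (O : ShiftOperad.{u}) {R S T : OmegaInj} (β : R ⟶ S) (α : S ⟶ T)
    (x : O.X T.obj) : O.hat (β ≫ α) x = O.hat β (O.hat α x) := by
  funext hR
  have hS : ¬ S.obj.IsEta := not_isEta_of_hom β hR.down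
  exact Subtype.ext (O.shiftNerve_pullback_shiftNerve β.property
    (O.pullback α.hom (x ⟨not_isEta_of_hom α hS⟩).1)).symm

/-- The semi-dendroidal space `T ↦ X_T`, `α ↦ α̂`. -/
noncomputable def semiDendroidalSpace (O : ShiftOperad.{u}) : SemiDendroidalSpace.{u} where
  obj T := TopCat.of (O.X T.unop.obj)
  map α := TopCat.ofHom ⟨O.hat α.unop, O.continuous_hat α.unop⟩
  map_id T := by
    ext x
    exact O.hat_id T.unop x
  map_comp α β := by
    ext x
    exact O.hat_comp β.unop α.unop x

end ShiftOperad

end Dendroidal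

theorem mainTheorem1 (O : Dendroidal.ShiftOperad.{u}) :
    (∃ (hc : ∀ {S T : Dendroidal.OmegaInj} (α : S ⟶ T), Continuous (O.hat α))
      (F : Dendroidal.SemiDendroidalSpace.{u})
      (hF : ∀ T : Dendroidal.OmegaInj, F.obj (Opposite.op T) = TopCat.of (O.X T.obj)),
      ∀ {S T : Dendroidal.OmegaInj} (α : S ⟶ T),
        F.map α.op =
          eqToHom (hF T) ≫ TopCat.ofHom ⟨O.hat α, hc α⟩ ≫ eqToHom (hF S).symm) ∧
    (∀ {T₀ T₁ T₂ T₃ : Dendroidal.OmegaInj} (δ : T₀ ⟶ T₁) (ε : T₁ ⟶ T₃) (δ' : T₀ ⟶ T₂)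
      (ε' : T₂ ⟶ T₃), δ ≫ ε = δ' ≫ ε' → O.hat δ ∘ O.hat ε = O.hat δ' ∘ O.hat ε') := by
  refine ⟨⟨O.continuous_hat, O.semiDendroidalSpace, fun _ => rfl, fun α => ?_⟩, ?_⟩
  · rfl
  · intro T₀ T₁ T₂ T₃ δ ε δ' ε' h
    funext x
    simp only [Function.comp_apply, ← O.hat_comp, h]
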